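/- Let $G$ be a finite simple graph and let $\mathcal{G}$ be a finite Abelian group, written additively. An edge labelling $f\colon E(G)\to\mathcal{G}$ is called $\mathcal{G}$-irregular if the weighted degrees $w(v)=\sum_{e\ni v} f(e)$, $v\in V(G)$, are pairwise distinct. The group irregularity strength $s_g(G)$ is the smallest positive integer $s$ such that for every Abelian group $\mathcal{G}$ of order $s$ there exists a $\mathcal{G}$-irregular labelling of $G$. Theorem 1.1. Let $G$ be a connected finite simple graph of order $n\ge 3$. Then $s_g(G)$ exists and $$ s_g(G)=\begin{cases} n+2 & \text{if } G\cong K_{1,3^{2q+1}-2} \text{ for some integer } q\ge 1,\\ n+1 & \text{if } n\equiv 2 \pmod 4 \text{ and } G\not\cong K_{1,3^{2q+1}-2} \text{ for every integer } q\ge 1,\\ n & \text{otherwise.} \end{cases} $$ -/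

import Mathlib

namespace GroupIrregularity

/-- The weighted degree `w(v) = ∑_{e ∋ v} f(e)` of the vertex `v` under the edge labelling `f`. -/
def weightedDegree {V : Type*} [Fintype V] [DecidableEq V] (G : SimpleGraph V)
    [DecidableRel G.Adj] {A : Type*} [AddCommGroup A] (f : G.edgeSet → A) (v : V) : A :=
  ∑ e ∈ Finset.univ.filter (fun e : G.edgeSet => v ∈ (e : Sym2 V)), f e

/-- A labelling of the edges by elements of an Abelian group is irregular if the weighted degrees
of the vertices are pairwise distinct. -/
def IsIrregular {V : Type*} [Fintype V] [DecidableEq V] (G : SimpleGraph V)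
    [DecidableRel G.Adj] {A : Type*} [AddCommGroup A] (f : G.edgeSet → A) : Prop :=
  Function.Injective (weightedDegree G f)

/-- Every Abelian group of order `s` admits an irregular labelling of `G`. The groups range over
`Type`, which contains every finite group up to isomorphism. -/
def AllGroupsIrregular {V : Type*} [Fintype V] [DecidableEq V] (G : SimpleGraph V)
    [DecidableRel G.Adj] (s : ℕ) : Prop :=
  ∀ (A : Type) [AddCommGroup A] [Finite A], Nat.card A = s →
    ∃ f : G.edgeSet → A, IsIrregular G f

/-- The group irregularity strength: the smallest `s ≥ 1` such that every Abelian group of order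
`s` admits an irregular labelling of `G` (there is no group of order `0`, so `s = 0` has to be
excluded). If there is no such `s`, the value is `0`; a positive value is always attained. -/
noncomputable def groupIrregularityStrength {V : Type*} [Fintype V] [DecidableEq V]
    (G : SimpleGraph V) [DecidableRel G.Adj] : ℕ :=
  sInf {s : ℕ | 1 ≤ s ∧ AllGroupsIrregular G s}

/-- `G` is isomorphic to the star `K_{1, 3^{2q+1} - 2}` for some integer `q ≥ 1`. -/
def IsExceptionalStar {V : Type*} (G : SimpleGraph V) : Prop :=
  ∃ q : ℕ, 1 ≤ q ∧
    Nonempty (G ≃g completeBipartiteGraph (Fin 1) (Fin (3 ^ (2 * q + 1) - 2)))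

end GroupIrregularity

/-!
The weighted degrees that edge labellings of a connected graph can produce are easy to describe.
Labelling a walk alternately with `g` and `-g` changes only the weights of its two ends, so every
weight vector can be moved to one vertex. If the graph has a proper 2-colouring, the realizable
vectors are those with equal sums over both colour classes (`IsColorClass.mem_realizable_of_sum_eq`
and `IsColorClass.sum_weightedDegree`); otherwise it is enough that the total sum lies in `2A`
(`mem_realizable_of_not_colorable`). For a 2-colourable graph with classes of sizes `k` and `l`, an
irregular labelling therefore amounts to two disjoint subsets of `A` of sizes `k` and `l` with equal
sums, called a balanced pair below.

Balanced pairs are built from pairs `x, -x`, which contribute nothing to a sum, and a few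
exceptional elements. If the order `n` of the group is odd or divisible by 4, the sum of all its
elements lies in `2A`, and this leads to balanced pairs of all sizes with `k + l = n`
(`hasBalancedPair_of_card_eq`). If `n ≡ 2 [MOD 4]`, groups of order `n + 1` have odd order and
contain balanced pairs with `k + l = n`, unless `k = 1` (or `l = 1`) and the group has exponent 3
(`hasBalancedPair_of_even`, `hasBalancedPair_of_card_eq_add_one`). A class of size 1 means that the
graph is a star, and exponent 3 means that `n + 1` is a power of 3, with odd exponent because of
`n ≡ 2 [MOD 4]`: this is the exceptional star. Its order plus 2 is divisible by 4 and not a power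
of 2, which is enough for a balanced pair of sizes 1 and `n - 1`
(`hasBalancedPair_one_of_card_eq_add_two`).

For the lower bounds, fewer than `n` elements are too few. If `n ≡ 2 [MOD 4]`, the sum of all
elements of `ZMod n` is not in `2A`, whereas the sum of the weighted degrees always is
(`not_allGroupsIrregular_card`). On a star of order `3 ^ r - 1`, the weighted degree of the centre
would have to be the one element of `(ZMod 3) ^ r` that is left out
(`not_allGroupsIrregular_card_add_one`).
-/

namespace GroupIrregularity

open Finset

/-! ### Two-colourings of a connected graph -/

section ColorClass

variable {V : Type*} {G : SimpleGraph V}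

/-- `C` and its complement are the colour classes of a proper 2-colouring of `G`. -/
def IsColorClass (G : SimpleGraph V) (C : Finset V) : Prop :=
  ∀ ⦃u v⦄, G.Adj u v → (u ∈ C ↔ v ∉ C)

theorem exists_isColorClass [Fintype V] (h : G.Colorable 2) : ∃ C : Finset V, IsColorClass G C := by
  obtain ⟨c⟩ := h
  refine ⟨univ.filter fun v => c v = 0, fun u v huv => ?_⟩
  have := c.valid huv
  simp only [mem_filter, mem_univ, true_and]
  omega

theorem exists_isColorClass_singleton_of_iso [Fintype V] {k : ℕ}
    (e : G ≃g completeBipartiteGraph (Fin 1) (Fin k)) :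
    ∃ c : V, IsColorClass G {c} ∧ Fintype.card V = k + 1 := by
  refine ⟨e.symm (Sum.inl 0), ?_, ?_⟩
  · intro u v h
    have h' := e.map_rel_iff.2 h
    have hx (x : V) : x = e.symm (Sum.inl 0) ↔ (e x).isLeft := by
      constructor
      · rintro rfl; simp
      · intro hx
        obtain ⟨i, hi⟩ := Sum.isLeft_iff.1 hx
        rw [Subsingleton.elim 0 i, ← hi]
        exact (e.symm_apply_apply x).symm
    rw [mem_singleton, mem_singleton, hx, hx]
    rcases h' with h' | h' <;> rcases hu : e u <;> rcases hv : e v <;> simp_all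
  · rw [Fintype.card_congr e.toEquiv]
    simp [add_comm]

variable [DecidableEq V]

theorem IsColorClass.neg_one_pow_length {C : Finset V} (hC : IsColorClass G C) {u v : V}
    (p : G.Walk u v) :
    (-1 : ℤ) ^ p.length = (if u ∈ C then 1 else -1) * (if v ∈ C then 1 else -1) := by
  induction p with
  | nil => split_ifs <;> rfl
  | cons h p ih =>
    have := hC h
    rw [SimpleGraph.Walk.length_cons, pow_succ, ih]
    split_ifs <;> simp_all

variable [Fintype V]

theorem IsColorClass.compl {C : Finset V} (hC : IsColorClass G C) : IsColorClass G Cᶜ := by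
  intro u v h
  have := hC h
  simp only [mem_compl]
  tauto

theorem IsColorClass.nonempty {C : Finset V} (hC : IsColorClass G C) (hG : G.Connected)
    (hn : 2 ≤ Fintype.card V) : C.Nonempty := by
  obtain ⟨r⟩ := hG.nonempty
  have : Nontrivial V := Fintype.one_lt_card_iff_nontrivial.1 hn
  obtain ⟨v, hv⟩ := hG.preconnected.exists_adj_of_nontrivial r
  by_cases hr : r ∈ C
  · exact ⟨r, hr⟩
  · have := hC hv
    exact ⟨v, by tauto⟩

/-- A connected graph with a colour class of one vertex is a star. -/
theorem IsColorClass.nonempty_iso_star {c : V} (hC : IsColorClass G {c}) (hG : G.Connected) {k : ℕ}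
    (hk : Fintype.card V = k + 1) (hk1 : 1 ≤ k) :
    Nonempty (G ≃g completeBipartiteGraph (Fin 1) (Fin k)) := by
  have : Nontrivial V := Fintype.one_lt_card_iff_nontrivial.1 (by omega)
  have hadj (u v : V) : G.Adj u v ↔ (u = c ∧ v ≠ c) ∨ (u ≠ c ∧ v = c) := by
    constructor
    · intro h
      have := hC h
      simp only [mem_singleton] at this
      tauto
    · have hc (v : V) (hv : v ≠ c) : G.Adj v c := by
        obtain ⟨x, hx⟩ := hG.preconnected.exists_adj_of_nontrivial v
        have := hC hx
        simp only [mem_singleton] at this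
        have hxc : x = c := by tauto
        exact hxc ▸ hx
      rintro (⟨rfl, h⟩ | ⟨h, rfl⟩)
      · exact (hc v h).symm
      · exact hc u h
  have hcard : Fintype.card {v // ¬ v = c} = k := by
    rw [Fintype.card_subtype_compl, Fintype.card_subtype_eq, hk]; rfl
  let e1 : {v // v = c} ≃ Fin 1 := Fintype.equivFinOfCardEq (Fintype.card_subtype_eq c)
  let e2 : {v // ¬ v = c} ≃ Fin k := Fintype.equivFinOfCardEq hcard
  refine ⟨⟨(Equiv.sumCompl (· = c)).symm.trans (Equiv.sumCongr e1 e2), ?_⟩⟩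
  intro u v
  rw [hadj]
  by_cases hu : u = c <;> by_cases hv : v = c <;>
    simp [hu, hv, Equiv.sumCompl_symm_apply_of_pos, Equiv.sumCompl_symm_apply_of_neg]

theorem IsColorClass.one_le_card {C : Finset V} (hC : IsColorClass G C) (hG : G.Connected)
    (hn : 2 ≤ Fintype.card V) : 1 ≤ #C ∧ 1 ≤ #Cᶜ :=
  ⟨card_pos.2 (hC.nonempty hG hn), card_pos.2 (hC.compl.nonempty hG hn)⟩

end ColorClass

/-! ### Weights realized by edge labellings -/

section Realizable

variable {V : Type*} [Fintype V] [DecidableEq V] (G : SimpleGraph V) [DecidableRel G.Adj]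
  {A : Type*} [AddCommGroup A]

/-- The subgroup of `V → A` formed by the weighted degrees of all edge labellings of `G`. -/
def realizable (A : Type*) [AddCommGroup A] : AddSubgroup (V → A) :=
  AddMonoidHom.range
    { toFun := fun f : G.edgeSet → A => weightedDegree G f
      map_zero' := by ext v; simp [weightedDegree]
      map_add' := fun f g => by ext v; simp [weightedDegree, sum_add_distrib] }

variable {G}

theorem sum_single {ι V A : Type*} [DecidableEq V] [AddCommGroup A] (s : Finset ι) (r : V)
    (f : ι → A) : ∑ i ∈ s, (Pi.single r (f i) : V → A) = Pi.single r (∑ i ∈ s, f i) :=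
  (map_sum (AddMonoidHom.single (fun _ : V => A) r) f s).symm

theorem mem_realizable {w : V → A} :
    w ∈ realizable G A ↔ ∃ f : G.edgeSet → A, weightedDegree G f = w := Iff.rfl

theorem single_add_single_mem_realizable {u v : V} (h : G.Adj u v) (g : A) :
    Pi.single u g + Pi.single v g ∈ realizable G A := by
  refine ⟨Pi.single ⟨s(u, v), h⟩ g, ?_⟩
  ext x
  have hne := h.ne
  simp only [AddMonoidHom.coe_mk, ZeroHom.coe_mk, weightedDegree, Pi.add_apply, Pi.single_apply]
  by_cases hu : x = u
  · subst hu; simp [hne]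
  · by_cases hv : x = v
    · subst hv; simp [hu]
    · simp [hu, hv]

/-- Labels `g, -g, g, …` along a walk cancel at its inner vertices. -/
theorem single_sub_single_mem_realizable_of_walk {u v : V} (p : G.Walk u v) (g : A) :
    Pi.single u g - Pi.single v ((-1 : ℤ) ^ p.length • g) ∈ realizable G A := by
  induction p generalizing g with
  | nil => simp [zero_mem]
  | @cons a b c h p ih =>
    have h1 := add_mem (single_add_single_mem_realizable h g) (ih (-g))
    have h2 : (-1 : ℤ) ^ (p.length + 1) • g = (-1 : ℤ) ^ p.length • (-g) := by
      rw [pow_succ]; simp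
    rw [SimpleGraph.Walk.length_cons, h2]
    convert h1 using 1
    rw [Pi.single_neg]
    abel

/-- In a connected graph with an odd closed walk, `Pi.single u (2g)` is realizable, so every weight
vector can be moved to one vertex without regard to signs. -/
theorem mem_realizable_of_not_colorable (hG : G.Connected) (hc : ¬ G.Colorable 2) {w : V → A}
    {h : A} (hw : ∑ v, w v = h + h) : w ∈ realizable G A := by
  rw [SimpleGraph.two_colorable_iff_forall_loop_even] at hc
  push Not at hc
  obtain ⟨r, p, hp⟩ := hc
  have htwo (g : A) : Pi.single r (g + g) ∈ realizable G A := by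
    have := single_sub_single_mem_realizable_of_walk p g
    rw [(Nat.not_even_iff_odd.1 hp).neg_one_pow] at this
    simpa [Pi.single_neg, Pi.single_add] using this
  have hmove (v : V) (g : A) : Pi.single v g - Pi.single r g ∈ realizable G A := by
    obtain ⟨q⟩ := hG.preconnected v r
    have := single_sub_single_mem_realizable_of_walk q g
    rcases Nat.even_or_odd q.length with hq | hq
    · simpa [hq.neg_one_pow] using this
    · have h2 := sub_mem this (htwo g)
      rw [hq.neg_one_pow] at h2
      convert h2 using 1
      simp only [neg_smul, one_smul, Pi.single_neg, Pi.single_add]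
      abel
  have hsum := sum_mem fun v (_ : v ∈ univ) => hmove v (w v)
  rw [sum_sub_distrib, univ_sum_single, sum_single, hw] at hsum
  simpa using add_mem hsum (htwo h)

theorem IsColorClass.mem_realizable_of_sum_eq {C : Finset V} (hC : IsColorClass G C)
    (hG : G.Connected) {w : V → A} (hw : ∑ v ∈ C, w v = ∑ v ∈ Cᶜ, w v) : w ∈ realizable G A := by
  obtain ⟨r⟩ := hG.nonempty
  have hmove (v : V) : Pi.single v (w v) - Pi.single r
      ((if r ∈ C then 1 else -1 : ℤ) • if v ∈ C then w v else - w v) ∈ realizable G A := by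
    obtain ⟨q⟩ := hG.preconnected v r
    have := single_sub_single_mem_realizable_of_walk q (w v)
    rw [hC.neg_one_pow_length] at this
    convert this using 3
    split_ifs <;> simp
  have hsum := sum_mem fun v (_ : v ∈ univ) => hmove v
  have h0 : ∑ v, (if v ∈ C then w v else - w v) = 0 := by
    rw [← sum_add_sum_compl C, sum_congr rfl fun v hv => if_pos hv,
      sum_congr rfl fun v hv => if_neg (mem_compl.1 hv), sum_neg_distrib, hw, add_neg_cancel]
  rw [sum_sub_distrib, univ_sum_single, sum_single,
    ← smul_sum, h0] at hsum
  simpa using hsum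

theorem IsColorClass.sum_weightedDegree {C : Finset V} (hC : IsColorClass G C)
    (f : G.edgeSet → A) : ∑ v ∈ C, weightedDegree G f v = ∑ e, f e := by
  simp only [weightedDegree, sum_filter]
  rw [sum_comm]
  refine sum_congr rfl fun ⟨e, he⟩ _ => ?_
  induction e with
  | h a b =>
    have hab : G.Adj a b := he
    have := hC hab
    by_cases ha : a ∈ C
    · rw [sum_eq_single_of_mem a ha]
      · simp
      · rintro x hx hxa
        have : x ≠ b := by rintro rfl; exact this.1 ha hx
        simp [hxa, this]
    · have hb : b ∈ C := by tauto
      rw [sum_eq_single_of_mem b hb]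
      · simp
      · rintro x hx hxb
        have : x ≠ a := by rintro rfl; exact ha hx
        simp [hxb, this]

theorem sum_weightedDegree (f : G.edgeSet → A) :
    ∑ v, weightedDegree G f v = (∑ e, f e) + ∑ e, f e := by
  simp only [weightedDegree, sum_filter]
  rw [sum_comm, ← sum_add_distrib]
  refine sum_congr rfl fun ⟨e, he⟩ _ => ?_
  induction e with
  | h a b =>
    have hab : G.Adj a b := he
    rw [sum_eq_add_of_mem a b (mem_univ _) (mem_univ _) hab.ne]
    · simp
    · rintro x _ ⟨h1, h2⟩
      simp [h1, h2]

end Realizable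

/-! ### Balanced pairs of subsets of a finite Abelian group -/

section Balanced

variable {A : Type*} [AddCommGroup A] [DecidableEq A]

/-- A set without 2-torsion that is closed under negation contains a zero-sum subset of every even
size. -/
theorem exists_subset_sum_eq_zero (P : Finset A) (hP : ∀ x ∈ P, -x ∈ P ∧ x ≠ -x) (m : ℕ)
    (hm : 2 * m ≤ #P) : ∃ S ⊆ P, #S = 2 * m ∧ ∑ x ∈ S, x = 0 := by
  suffices h : ∃ S ⊆ P, (∀ x ∈ S, -x ∈ S) ∧ #S = 2 * m ∧ ∑ x ∈ S, x = 0 by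
    obtain ⟨S, h1, -, h2⟩ := h
    exact ⟨S, h1, h2⟩
  induction m with
  | zero => exact ⟨∅, by simp⟩
  | succ m ih =>
    obtain ⟨S, hSP, hneg, hcard, hsum⟩ := ih (by omega)
    obtain ⟨x, hxP, hxS⟩ := exists_mem_notMem_of_card_lt_card (show #S < #P by omega)
    obtain ⟨hnx, hne⟩ := hP x hxP
    have hnxS : -x ∉ S := fun h => hxS (by simpa using hneg _ h)
    have hx' : x ∉ insert (-x) S := by simp [hne, hxS]
    refine ⟨insert x (insert (-x) S), ?_, ?_, ?_, ?_⟩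
    · simp [insert_subset_iff, hxP, hnx, hSP]
    · intro y hy
      simp only [mem_insert] at hy ⊢
      rcases hy with rfl | rfl | hy
      · simp
      · simp
      · exact .inr (.inr (hneg y hy))
    · rw [card_insert_of_notMem hx', card_insert_of_notMem hnxS, hcard]; ring
    · rw [sum_insert hx', sum_insert hnxS, hsum]; simp

variable (A) in
/-- There are disjoint subsets of `A` of sizes `k` and `l` with the same sum. -/
def HasBalancedPair (k l : ℕ) : Prop :=
  ∃ X Y : Finset A, Disjoint X Y ∧ #X = k ∧ #Y = l ∧ ∑ x ∈ X, x = ∑ y ∈ Y, y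

omit [DecidableEq A] in
theorem HasBalancedPair.symm {k l : ℕ} (h : HasBalancedPair A k l) : HasBalancedPair A l k := by
  obtain ⟨X, Y, h1, h2, h3, h4⟩ := h
  exact ⟨Y, X, h1.symm, h3, h2, h4.symm⟩

/-- If `A` has exponent dividing `p`, its order is a power of `p`. -/
theorem exists_card_eq_pow {A : Type*} [AddCommGroup A] [Finite A] {p : ℕ} [Fact p.Prime]
    (h : ∀ x : A, p • x = 0) : ∃ r, Nat.card A = p ^ r := by
  let _ := AddCommGroup.zmodModule h
  exact ⟨_, by rw [Module.natCard_eq_pow_finrank (K := ZMod p), Nat.card_zmod]⟩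

variable [Fintype A]

omit [DecidableEq A] in
theorem exists_add_self_eq_of_odd (h : Odd (Fintype.card A)) (x : A) : ∃ y, y + y = x := by
  obtain ⟨m, hm⟩ := h
  refine ⟨(m + 1) • x, ?_⟩
  rw [← add_smul, show m + 1 + (m + 1) = Fintype.card A + 1 by omega, add_smul, card_nsmul_eq_zero]
  simp

omit [DecidableEq A] in
theorem eq_zero_of_add_self_eq_zero (h : Odd (Fintype.card A)) {x : A} (hx : x + x = 0) :
    x = 0 := by
  obtain ⟨m, hm⟩ := h
  have := card_nsmul_eq_zero (x := x)
  rw [hm, add_smul, mul_comm, mul_smul, two_nsmul, hx] at this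
  simpa using this

omit [DecidableEq A] in
theorem sum_add_sum_self : (∑ x : A, x) + ∑ x : A, x = 0 := by
  rw [← sub_neg_eq_add, sub_eq_zero, ← sum_neg_distrib]
  exact (Equiv.sum_comp (Equiv.neg A) id).symm

/-- The sum of all elements is divisible by 2 if the order is odd or divisible by 4. Otherwise a
homomorphism to `ZMod 2` killing `2A` would not vanish at the sum; but it is onto, so it takes the
value `1` at half of the elements, an even number. -/
theorem exists_add_self_eq_sum (h : ¬ Fintype.card A ≡ 2 [MOD 4]) :
    ∃ y : A, y + y = ∑ x : A, x := by
  rcases Nat.even_or_odd (Fintype.card A) with he | ho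
  swap
  · exact exists_add_self_eq_of_odd ho _
  have h4 : 4 ∣ Fintype.card A := by
    unfold Nat.ModEq at h
    rw [Nat.even_iff] at he
    omega
  by_contra hno
  let H : AddSubgroup A := (nsmulAddMonoidHom 2 : A →+ A).range
  have hH (x : A) : 2 • x ∈ H := ⟨x, rfl⟩
  let _ : Module (ZMod 2) (A ⧸ H) := QuotientAddGroup.zmodModule hH
  have hσ : ((∑ x : A, x : A) : A ⧸ H) ≠ 0 := by
    rw [Ne, QuotientAddGroup.eq_zero_iff]
    rintro ⟨y, hy⟩
    exact hno ⟨y, by rw [← hy]; simp [two_nsmul]⟩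
  obtain ⟨φ, hφ⟩ : ∃ φ : Module.Dual (ZMod 2) (A ⧸ H), φ ((∑ x : A, x : A) : A ⧸ H) ≠ 0 := by
    by_contra! hall
    exact hσ ((Module.forall_dual_apply_eq_zero_iff (ZMod 2) _).1 hall)
  let ψ : A →+ ZMod 2 := φ.toAddMonoidHom.comp (QuotientAddGroup.mk' H)
  have hψσ : ψ (∑ x : A, x) ≠ 0 := hφ
  have h01 (z : ZMod 2) : z ≠ 0 → z = 1 := by revert z; decide
  -- Translation by the sum exchanges the two fibres of `ψ`.
  have hfib : #{x | ψ x = 0} = #{x | ¬ ψ x = 0} := by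
    refine card_bij (fun x _ => x + ∑ x : A, x) ?_ ?_ ?_
    · intro x hx
      simp only [mem_filter, mem_univ, true_and, map_add] at hx ⊢
      simpa [hx] using hψσ
    · intro x _ y _ hxy
      exact add_right_cancel hxy
    · intro y hy
      simp only [mem_filter, mem_univ, true_and] at hy
      refine ⟨y - ∑ x : A, x, ?_, by simp⟩
      simp only [mem_filter, mem_univ, true_and]
      rw [map_sub, h01 _ hy, h01 _ hψσ, sub_self]
  have hsum : #{x | ψ x = 0} + #{x | ¬ ψ x = 0} = Fintype.card A :=
    card_filter_add_card_filter_not _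
  apply hψσ
  rw [map_sum, ← sum_filter_add_sum_filter_not univ (fun x => ψ x = 0),
    sum_congr rfl fun x hx => (mem_filter.1 hx).2,
    sum_congr rfl fun x hx => h01 _ (mem_filter.1 hx).2]
  simp only [sum_const_zero, sum_const, zero_add, nsmul_eq_mul, mul_one]
  rw [ZMod.natCast_eq_zero_iff]
  simp only [ne_eq] at hfib hsum ⊢
  omega

theorem neg_mem_filter_add_self_ne_zero {x : A}
    (hx : x ∈ univ.filter fun x : A => x + x ≠ 0) :
    -x ∈ univ.filter (fun x : A => x + x ≠ 0) ∧ x ≠ -x := by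
  simp only [mem_filter, mem_univ, true_and] at hx ⊢
  refine ⟨fun h => hx ?_, fun h => hx (eq_neg_iff_add_eq_zero.1 h)⟩
  rw [← neg_add, neg_eq_zero] at h
  exact h

theorem even_card_filter_add_self_ne_zero :
    Even #(univ.filter fun x : A => x + x ≠ 0) := by
  have h2 : ((#(univ.filter fun x : A => x + x ≠ 0) : ℕ) : ZMod 2) = 0 := by
    rw [← nsmul_one, ← sum_const]
    refine sum_involution (fun x _ => -x) (fun _ _ => by decide) ?_ ?_ ?_
    · intro x hx _
      exact (neg_mem_filter_add_self_ne_zero hx).2.symm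
    · intro x hx
      exact (neg_mem_filter_add_self_ne_zero hx).1
    · intro x _
      simp
  exact (ZMod.natCast_eq_zero_iff_even).1 h2

/-- A group whose order is odd or divisible by 4 splits into two parts of prescribed sizes with the
same sum. With `c + c` the sum of all elements, the first part consists of `c`, unless `c` is
2-torsion, some 2-torsion elements and some pairs `x, -x`. -/
theorem hasBalancedPair_of_card_eq {k l : ℕ} (hk : 1 ≤ k) (hl : 1 ≤ l)
    (hA : Fintype.card A = k + l) (h : ¬ Fintype.card A ≡ 2 [MOD 4]) :
    HasBalancedPair A k l := by
  obtain ⟨c, hc⟩ := exists_add_self_eq_sum h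
  suffices hX : ∃ X : Finset A, #X = k ∧ ∃ t, t + t = 0 ∧ ∑ x ∈ X, x = c + t by
    obtain ⟨X, hXk, t, ht, hX⟩ := hX
    refine ⟨X, Xᶜ, disjoint_compl_right, hXk, by rw [card_compl]; omega, ?_⟩
    have := sum_add_sum_compl X (fun x => x)
    rw [← hc] at this
    refine add_left_cancel (a := ∑ x ∈ X, x) ?_
    rw [this, hX, show c + t + (c + t) = c + c + (t + t) by abel, ht, add_zero]
  set P := univ.filter fun x : A => x + x ≠ 0 with hPdef
  set T := univ.filter fun x : A => x + x = 0 with hTdef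
  have hPT : #T + #P = k + l := by
    rw [← hA]; exact card_filter_add_card_filter_not _
  have hPeven : Even #P := even_card_filter_add_self_ne_zero
  have hT0 : 1 ≤ #T := card_pos.2 ⟨0, by simp [hTdef]⟩
  have hPneg (x : A) (hx : x ∈ P) := neg_mem_filter_add_self_ne_zero hx
  have hTsum {S : Finset A} (hS : S ⊆ T) : ∑ x ∈ S, x + ∑ x ∈ S, x = 0 := by
    rw [← sum_add_distrib]
    exact sum_eq_zero fun x hx => (mem_filter.1 (hS hx)).2
  by_cases hcT : c + c = 0
  · obtain ⟨j, m, hkj, hj, hm⟩ : ∃ j m, k = j + 2 * m ∧ j ≤ #T ∧ 2 * m ≤ #P := by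
      obtain ⟨p, hp⟩ := hPeven
      by_cases hkP : k ≤ #P
      · exact ⟨k % 2, k / 2, by omega, by omega, by omega⟩
      · exact ⟨k - #P, p, by omega, by omega, by omega⟩
    obtain ⟨S, hST, hSj⟩ := exists_subset_card_eq hj
    obtain ⟨Q, hQP, hQm, hQ⟩ := exists_subset_sum_eq_zero P hPneg m hm
    have hdis : Disjoint S Q := by
      refine disjoint_of_subset_left hST (disjoint_of_subset_right hQP ?_)
      exact disjoint_filter_filter_not _ _ _
    refine ⟨S ∪ Q, by rw [card_union_of_disjoint hdis]; omega, ∑ x ∈ S, x - c, ?_, ?_⟩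
    · rw [sub_add_sub_comm, hcT, hTsum hST, sub_zero]
    · rw [sum_union hdis, hQ]; abel
  · have hcP : c ∈ P := by simp [hPdef, hcT]
    have hncP : -c ∈ P := (hPneg c hcP).1
    have hcne := (hPneg c hcP).2
    set P' := P \ {c, -c} with hP'def
    have hP'card : #P' + 2 = #P := by
      have h1 : ({c, -c} : Finset A) ⊆ P := by simp [insert_subset_iff, hcP, hncP]
      have h2 := card_le_card h1
      rw [hP'def, card_sdiff_of_subset h1]
      rw [card_pair hcne] at h2 ⊢
      omega
    have hP'neg (x : A) (hx : x ∈ P') : -x ∈ P' ∧ x ≠ -x := by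
      simp only [hP'def, mem_sdiff, mem_insert, mem_singleton, not_or] at hx ⊢
      refine ⟨⟨(hPneg x hx.1).1, ?_, ?_⟩, (hPneg x hx.1).2⟩
      · rw [neg_eq_iff_eq_neg]; exact hx.2.2
      · rw [neg_inj]; exact hx.2.1
    obtain ⟨j, m, hkj, hj, hm⟩ : ∃ j m, k = 1 + j + 2 * m ∧ j ≤ #T ∧ 2 * m ≤ #P' := by
      obtain ⟨p, hp⟩ := hPeven
      by_cases hkP : k ≤ #P' + 1
      · exact ⟨(k - 1) % 2, (k - 1) / 2, by omega, by omega, by omega⟩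
      · exact ⟨k - 1 - #P', p - 1, by omega, by omega, by omega⟩
    obtain ⟨S, hST, hSj⟩ := exists_subset_card_eq hj
    obtain ⟨Q, hQP, hQm, hQ⟩ := exists_subset_sum_eq_zero P' hP'neg m hm
    have hdis : Disjoint S Q := by
      refine disjoint_of_subset_left hST
        (disjoint_of_subset_right (hQP.trans sdiff_subset) ?_)
      exact disjoint_filter_filter_not _ _ _
    have hcSQ : c ∉ S ∪ Q := by
      rw [mem_union]
      rintro (h | h)
      · exact hcT (mem_filter.1 (hST h)).2
      · simpa [hP'def] using hQP h
    refine ⟨insert c (S ∪ Q), ?_, ∑ x ∈ S, x, hTsum hST, ?_⟩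
    · rw [card_insert_of_notMem hcSQ, card_union_of_disjoint hdis]; omega
    · rw [sum_insert hcSQ, sum_union hdis, hQ, add_zero]

/-- In a group of odd order, a set that misses minus the double of its sum forms a balanced pair
with the complement of both. -/
theorem hasBalancedPair_of_neg_notMem (ho : Odd (Fintype.card A)) {k l : ℕ}
    (hA : Fintype.card A = k + l + 1) {X : Finset A} (hX : #X = k)
    (hz : -(∑ x ∈ X, x + ∑ x ∈ X, x) ∉ X) : HasBalancedPair A k l := by
  refine ⟨X, (insert (-(∑ x ∈ X, x + ∑ x ∈ X, x)) X)ᶜ, ?_, hX, ?_, ?_⟩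
  · exact disjoint_compl_right.mono_right (compl_subset_compl.2 (subset_insert _ _))
  · rw [card_compl, card_insert_of_notMem hz]; omega
  · have h1 := sum_add_sum_compl (insert (-(∑ x ∈ X, x + ∑ x ∈ X, x)) X) (fun x => x)
    rw [eq_zero_of_add_self_eq_zero ho sum_add_sum_self, sum_insert hz] at h1
    rw [eq_neg_of_add_eq_zero_right h1]
    abel

theorem hasBalancedPair_of_even (ho : Odd (Fintype.card A)) {k l : ℕ}
    (hA : Fintype.card A = k + l + 1) (hk : Even k) : HasBalancedPair A k l := by
  obtain ⟨m, hm⟩ := hk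
  have hsub : univ.erase (0 : A) ⊆ univ.filter fun x : A => x + x ≠ 0 := by
    intro x hx
    simp only [mem_filter, mem_univ, true_and]
    exact fun h => (mem_erase.1 hx).1 (eq_zero_of_add_self_eq_zero ho h)
  have hcard := card_le_card hsub
  rw [card_erase_of_mem (mem_univ _), card_univ] at hcard
  obtain ⟨X, hXP, hX, hsum⟩ := exists_subset_sum_eq_zero (univ.filter fun x : A => x + x ≠ 0)
    (fun x hx => neg_mem_filter_add_self_ne_zero hx) m (by omega)
  refine hasBalancedPair_of_neg_notMem ho hA (X := X) (by omega) fun h => ?_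
  rw [hsum, add_zero, neg_zero] at h
  simpa using hXP h

/-- A group of odd order `k + l + 1` contains a balanced pair of odd sizes `k ≤ l`; for `k = 1`
the exponent must not be 3. For an `x` with `3x ≠ 0`, the smaller part consists of `x` and pairs
`y, -y`, and the element left out is `-2x`. In exponent 3 it consists of `0`, two independent
elements `a`, `b` and pairs `y, -y`, and the element left out is `a + b`. -/
theorem hasBalancedPair_of_card_eq_add_one {k l : ℕ} (hk : Odd k) (hl : Odd l) (hkl : k ≤ l)
    (hl3 : 3 ≤ l) (hA : Fintype.card A = k + l + 1)
    (h3 : k = 1 → ∃ x : A, x + x + x ≠ 0) : HasBalancedPair A k l := by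
  obtain ⟨k', rfl⟩ := hk
  obtain ⟨l', rfl⟩ := hl
  have ho : Odd (Fintype.card A) := ⟨k' + l' + 1, by omega⟩
  have hsymm (D : Finset A) (h0 : 0 ∈ D) (hD : ∀ x ∈ D, -x ∈ D) (x : A) (hx : x ∈ Dᶜ) :
      -x ∈ Dᶜ ∧ x ≠ -x := by
    rw [mem_compl] at hx ⊢
    refine ⟨fun h => hx (by simpa using hD _ h), fun h => hx ?_⟩
    rw [eq_zero_of_add_self_eq_zero ho (eq_neg_iff_add_eq_zero.1 h)]
    exact h0
  by_cases hx : ∃ x : A, x + x + x ≠ 0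
  · obtain ⟨x, hx⟩ := hx
    set D : Finset A := {0, x, -x, x + x, -(x + x)} with hD
    have hDcard : #D ≤ 5 := card_le_five
    obtain ⟨S, hSD, hSk, hS⟩ := exists_subset_sum_eq_zero Dᶜ
      (hsymm D (by simp [hD]) (by intro y hy; simp [hD] at hy ⊢; aesop)) k'
      (by rw [card_compl]; omega)
    have hxS : x ∉ S := fun h => by simpa [hD] using hSD h
    have hxS' : -(x + x) ∉ S := fun h => by simpa [hD] using hSD h
    refine hasBalancedPair_of_neg_notMem ho hA (X := insert x S) ?_ ?_
    · rw [card_insert_of_notMem hxS, hSk]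
    · rw [sum_insert hxS, hS, add_zero, mem_insert, not_or]
      refine ⟨fun h => hx ?_, hxS'⟩
      nth_rewrite 3 [← h]
      abel
  · have hk' : k' ≠ 0 := fun h => hx (h3 (by omega))
    push Not at hx
    have hneg (x : A) : -(x + x) = x := neg_eq_of_add_eq_zero_right (hx x)
    obtain ⟨a, ha⟩ : ∃ a : A, a ≠ 0 := by
      have : Nontrivial A := Fintype.one_lt_card_iff_nontrivial.1 (by omega)
      exact exists_ne 0
    obtain ⟨b, -, hb⟩ := exists_mem_notMem_of_card_lt_card
      (show #({0, a, -a} : Finset A) < #(univ : Finset A) by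
        have : #({0, a, -a} : Finset A) ≤ 3 := card_le_three
        rw [card_univ]; omega)
    simp only [mem_insert, mem_singleton, not_or] at hb
    obtain ⟨hb0, hba, hbna⟩ := hb
    have hab : a + b ≠ 0 := fun h => hbna (eq_neg_of_add_eq_zero_right h)
    set D : Finset A := {0, a, -a, b, -b, a + b, -(a + b)} with hD
    have hDcard : #D ≤ 7 := (card_insert_le _ _).trans (Nat.succ_le_succ card_le_six)
    obtain ⟨S, hSD, hSk, hS⟩ := exists_subset_sum_eq_zero Dᶜ
      (hsymm D (by simp [hD]) (by intro y hy; simp [hD] at hy ⊢; aesop)) (k' - 1)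
      (by rw [card_compl]; omega)
    have h0S : 0 ∉ S := fun h => by simpa [hD] using hSD h
    have haS : a ∉ S := fun h => by simpa [hD] using hSD h
    have hbS : b ∉ S := fun h => by simpa [hD] using hSD h
    have habS : a + b ∉ S := fun h => by simpa [hD] using hSD h
    have hb' : b ∉ insert 0 S := by simp [hb0, hbS]
    have ha' : a ∉ insert b (insert 0 S) := by simp [ha, Ne.symm hba, haS]
    refine hasBalancedPair_of_neg_notMem ho hA (X := insert a (insert b (insert 0 S))) ?_ ?_
    · rw [card_insert_of_notMem ha', card_insert_of_notMem hb', card_insert_of_notMem h0S, hSk]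
      omega
    · rw [sum_insert ha', sum_insert hb', sum_insert h0S, hS, add_zero, add_zero, hneg]
      simp [ha, hb0, hab, habS]

/-- In a group of order `l + 3` that is odd or divisible by 4, `0` is the sum of `l` other elements,
unless the exponent is 2. With `d + d` the sum of all elements, the two elements
left out are `d + t` and `d - t`. -/
theorem hasBalancedPair_one_of_card_eq_add_two {l : ℕ} (hA : Fintype.card A = l + 3)
    (hl : 2 ≤ l) (h : ¬ Fintype.card A ≡ 2 [MOD 4]) (h2 : ∃ x : A, x + x ≠ 0) :
    HasBalancedPair A 1 l := by
  obtain ⟨d, hd⟩ := exists_add_self_eq_sum h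
  obtain ⟨x, hx⟩ := h2
  set T := univ.filter fun x : A => x + x = 0 with hTdef
  -- The translate of the 2-torsion by `x` is disjoint from it.
  have hT : 2 * #T ≤ Fintype.card A := by
    have hdis : Disjoint T (T.map (addRightEmbedding x)) := by
      rw [disjoint_left]
      intro y hy hy'
      obtain ⟨z, hz, rfl⟩ := mem_map.1 hy'
      simp only [hTdef, mem_filter, mem_univ, true_and, addRightEmbedding_apply] at hy hz
      rw [add_add_add_comm, hz, zero_add] at hy
      exact hx hy
    have := card_le_univ (T ∪ T.map (addRightEmbedding x))
    rw [card_union_of_disjoint hdis, card_map] at this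
    omega
  obtain ⟨t, -, ht⟩ := exists_mem_notMem_of_card_lt_card
    (show #(T ∪ {d, -d}) < #(univ : Finset A) by
      have h1 := card_union_le T {d, -d}
      have h2 : #({d, -d} : Finset A) ≤ 2 := card_le_two
      rw [card_univ]; omega)
  simp only [hTdef, mem_union, mem_filter, mem_univ, true_and, mem_insert, mem_singleton,
    not_or] at ht
  obtain ⟨htT, htd, htnd⟩ := ht
  have h1 : d + t ≠ d - t := fun h => htT (by
    rw [← sub_eq_zero] at h
    rw [← h]; abel)
  have h2 : (0 : A) ≠ d + t := fun h => htnd (eq_neg_of_add_eq_zero_right h.symm)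
  have h3 : (0 : A) ≠ d - t := fun h => htd (sub_eq_zero.1 h.symm).symm
  have h0 : (0 : A) ∉ ({d + t, d - t} : Finset A) := by simp [h2, h3]
  refine ⟨{0}, (insert 0 {d + t, d - t})ᶜ, ?_, card_singleton _, ?_, ?_⟩
  · rw [disjoint_singleton_left, mem_compl, not_not]
    exact mem_insert_self _ _
  · rw [card_compl, card_insert_of_notMem h0, card_pair h1]; omega
  · have := sum_add_sum_compl (insert 0 {d + t, d - t} : Finset A) (fun x => x)
    rw [sum_insert h0, sum_pair h1, ← hd, zero_add, show d + t + (d - t) = d + d by abel] at this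
    rw [sum_singleton, left_eq_add.1 this.symm]

end Balanced

/-! ### Irregular labellings from balanced pairs -/

section Existence

variable {V : Type*} [Fintype V] [DecidableEq V] {G : SimpleGraph V} [DecidableRel G.Adj]

theorem IsColorClass.exists_isIrregular {A : Type*} [AddCommGroup A] {C : Finset V}
    (hC : IsColorClass G C) (hG : G.Connected) (h : HasBalancedPair A #C #Cᶜ) :
    ∃ f : G.edgeSet → A, IsIrregular G f := by
  obtain ⟨X, Y, hXY, hX, hY, hsum⟩ := h
  let e1 : C ≃ X := equivOfCardEq hX.symm
  let e2 : (Cᶜ : Finset V) ≃ Y := equivOfCardEq hY.symm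
  let w : V → A := fun v => if h : v ∈ C then e1 ⟨v, h⟩ else e2 ⟨v, mem_compl.2 h⟩
  have hw1 (v : C) : w v = e1 v := by simp [w]
  have hw2 (v : (Cᶜ : Finset V)) : w v = e2 v := by simp [w, mem_compl.1 v.2]
  have hs1 : ∑ v ∈ C, w v = ∑ x ∈ X, x := by
    rw [← sum_coe_sort C, ← sum_coe_sort X, ← e1.sum_comp]
    exact sum_congr rfl fun v _ => hw1 v
  have hs2 : ∑ v ∈ Cᶜ, w v = ∑ y ∈ Y, y := by
    rw [← sum_coe_sort Cᶜ, ← sum_coe_sort Y, ← e2.sum_comp]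
    exact sum_congr rfl fun v _ => hw2 v
  obtain ⟨f, hf⟩ := mem_realizable.1
    (hC.mem_realizable_of_sum_eq hG (w := w) (by rw [hs1, hs2, hsum]))
  refine ⟨f, ?_⟩
  rw [IsIrregular, hf]
  intro u v huv
  by_cases hu : u ∈ C <;> by_cases hv : v ∈ C
  · rw [hw1 ⟨u, hu⟩, hw1 ⟨v, hv⟩] at huv
    simpa using e1.injective (Subtype.ext huv)
  · rw [hw1 ⟨u, hu⟩, hw2 ⟨v, mem_compl.2 hv⟩] at huv
    exact absurd huv (disjoint_iff_ne.1 hXY _ (e1 _).2 _ (e2 _).2)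
  · rw [hw2 ⟨u, mem_compl.2 hu⟩, hw1 ⟨v, hv⟩] at huv
    exact absurd huv.symm (disjoint_iff_ne.1 hXY _ (e1 _).2 _ (e2 _).2)
  · rw [hw2 ⟨u, mem_compl.2 hu⟩, hw2 ⟨v, mem_compl.2 hv⟩] at huv
    simpa using e2.injective (Subtype.ext huv)

theorem exists_isIrregular_of_not_colorable {A : Type*} [AddCommGroup A] (hG : G.Connected)
    (hc : ¬ G.Colorable 2) {w : V → A} (hw : Function.Injective w)
    (h : ∃ y, y + y = ∑ v, w v) : ∃ f : G.edgeSet → A, IsIrregular G f := by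
  obtain ⟨y, hy⟩ := h
  obtain ⟨f, hf⟩ := mem_realizable.1 (mem_realizable_of_not_colorable hG hc hy.symm)
  exact ⟨f, by rwa [IsIrregular, hf]⟩

theorem allGroupsIrregular_card (hG : G.Connected) (hn : 3 ≤ Fintype.card V)
    (h4 : ¬ Fintype.card V ≡ 2 [MOD 4]) : AllGroupsIrregular G (Fintype.card V) := by
  classical
  intro A _ _ hA
  let _ := Fintype.ofFinite A
  rw [Nat.card_eq_fintype_card] at hA
  by_cases hc : G.Colorable 2
  · obtain ⟨C, hC⟩ := exists_isColorClass hc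
    obtain ⟨h1, h2⟩ := hC.one_le_card hG (by omega)
    exact hC.exists_isIrregular hG
      (hasBalancedPair_of_card_eq h1 h2 (by rw [hA, card_add_card_compl]) (by rwa [hA]))
  · let e : V ≃ A := Fintype.equivOfCardEq hA.symm
    refine exists_isIrregular_of_not_colorable hG hc e.injective ?_
    rw [e.sum_comp (fun x => x)]
    exact exists_add_self_eq_sum (by rwa [hA])

theorem allGroupsIrregular_card_add_one (hG : G.Connected) (hn : 3 ≤ Fintype.card V)
    (h4 : Fintype.card V ≡ 2 [MOD 4]) (hstar : ¬ IsExceptionalStar G) :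
    AllGroupsIrregular G (Fintype.card V + 1) := by
  classical
  intro A _ _ hA
  let _ := Fintype.ofFinite A
  rw [Nat.card_eq_fintype_card] at hA
  unfold Nat.ModEq at h4
  have ho : Odd (Fintype.card A) := by rw [Nat.odd_iff]; omega
  by_cases hc : G.Colorable 2
  swap
  · obtain ⟨e⟩ : Nonempty (V ↪ A) := Function.Embedding.nonempty_of_card_le (by omega)
    exact exists_isIrregular_of_not_colorable hG hc e.injective (exists_add_self_eq_of_odd ho _)
  -- If the order is a power of 3, the exponent is odd because the order is 3 modulo 4.
  have key (C : Finset V) (hC : IsColorClass G C) (hk : #C = 1) : ∃ x : A, x + x + x ≠ 0 := by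
    by_contra! h3
    obtain ⟨r, hr⟩ := exists_card_eq_pow (A := A) (p := 3) fun x => by
      rw [← h3 x, succ_nsmul, two_nsmul]
    rw [Nat.card_eq_fintype_card, hA] at hr
    obtain ⟨c, rfl⟩ := card_eq_one.1 hk
    rcases Nat.even_or_odd' r with ⟨q, rfl | rfl⟩
    · have : 3 ^ (2 * q) % 4 = 1 := by
        rw [pow_mul, Nat.pow_mod]; simp
      omega
    · refine hstar ⟨q, ?_, hC.nonempty_iso_star hG (by omega) (by omega)⟩
      by_contra! hq
      interval_cases q
      omega
  obtain ⟨C, hC⟩ := exists_isColorClass hc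
  obtain ⟨h1, h2⟩ := hC.one_le_card hG (by omega)
  have hcard := card_add_card_compl C
  refine hC.exists_isIrregular hG ?_
  rcases Nat.even_or_odd #C with he | hodd
  · exact hasBalancedPair_of_even ho (by omega) he
  · have hodd' : Odd #Cᶜ := by
      rw [Nat.odd_iff] at hodd ⊢; omega
    rcases le_total #C #Cᶜ with hle | hle
    · exact hasBalancedPair_of_card_eq_add_one hodd hodd' hle (by omega) (by omega) (key C hC)
    · exact (hasBalancedPair_of_card_eq_add_one hodd' hodd hle (by omega) (by omega)
        (key Cᶜ hC.compl)).symm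

theorem allGroupsIrregular_exceptionalStar {q : ℕ} (hG : G.Connected) (hq : 1 ≤ q) {c : V}
    (hC : IsColorClass G {c}) (hV : Fintype.card V + 1 = 3 ^ (2 * q + 1)) :
    AllGroupsIrregular G (Fintype.card V + 2) := by
  classical
  intro A _ _ hA
  let _ := Fintype.ofFinite A
  rw [Nat.card_eq_fintype_card] at hA
  -- Hence the order of the group, `3 ^ (2 * q + 1) + 1`, is 4 modulo 8: not a power of 2.
  have h8 : 3 ^ (2 * q + 1) % 8 = 3 := by
    rw [pow_succ, pow_mul, Nat.mul_mod, Nat.pow_mod]; simp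
  have h27 : 3 ^ 3 ≤ 3 ^ (2 * q + 1) := Nat.pow_le_pow_right (by norm_num) (by omega)
  have hcard := card_add_card_compl ({c} : Finset V)
  rw [card_singleton] at hcard
  refine hC.exists_isIrregular hG ?_
  rw [card_singleton]
  refine hasBalancedPair_one_of_card_eq_add_two (by omega) (by omega) ?_ ?_
  · unfold Nat.ModEq; omega
  · by_contra! h2
    obtain ⟨r, hr⟩ := exists_card_eq_pow (A := A) (p := 2) fun x => by rw [two_nsmul, h2]
    rw [Nat.card_eq_fintype_card] at hr
    rcases lt_or_ge r 3 with h | h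
    · interval_cases r <;> omega
    · have := (pow_dvd_pow 2 h).trans hr.symm.dvd
      omega

end Existence

/-! ### Orders without an irregular labelling -/

section Obstruction

variable {V : Type*} [Fintype V] [DecidableEq V] {G : SimpleGraph V} [DecidableRel G.Adj]

theorem card_le_of_allGroupsIrregular {s : ℕ} (hs : 1 ≤ s) (h : AllGroupsIrregular G s) :
    Fintype.card V ≤ s := by
  have : NeZero s := ⟨by omega⟩
  obtain ⟨f, hf⟩ := h (ZMod s) (Nat.card_zmod s)
  simpa [ZMod.card] using Fintype.card_le_of_injective _ hf

/-- If the order is 2 modulo 4, the sum of `ZMod n` is odd, while the weighted degrees add up to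
twice the sum of the labels. -/
theorem not_allGroupsIrregular_card (h4 : Fintype.card V ≡ 2 [MOD 4]) :
    ¬ AllGroupsIrregular G (Fintype.card V) := by
  intro h
  set n := Fintype.card V with hn
  unfold Nat.ModEq at h4
  have : NeZero n := ⟨by omega⟩
  obtain ⟨f, hf⟩ := h (ZMod n) (Nat.card_zmod n)
  have hbij := (Fintype.bijective_iff_injective_and_card (weightedDegree G f)).2
    ⟨hf, by rw [ZMod.card]⟩
  have hsum := sum_weightedDegree f
  rw [hbij.sum_comp (fun x => x)] at hsum
  have h2 : 2 ∣ n := by omega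
  have hsum' := congrArg (ZMod.castHom h2 (ZMod 2)) hsum
  rw [map_add, CharTwo.add_self_eq_zero] at hsum'
  have hrange : ∑ x : ZMod n, x = ((∑ i ∈ range n, i : ℕ) : ZMod n) := by
    rw [Nat.cast_sum]
    refine sum_bij (fun x _ => x.val) (fun x _ => mem_range.2 x.val_lt)
      (fun x _ y _ hxy => ZMod.val_injective n hxy)
      (fun i hi => ⟨i, mem_univ _, ZMod.val_cast_of_lt (mem_range.1 hi)⟩) ?_
    intro x _
    simp
  rw [hrange, map_natCast, ZMod.natCast_eq_zero_iff] at hsum'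
  obtain ⟨m, hm⟩ := h2
  have hodd : m % 2 = 1 := by omega
  have hgauss := sum_range_id_mul_two n
  obtain ⟨t, ht⟩ := hsum'
  rw [ht, hm] at hgauss
  have h5 : 2 * t = m * (2 * m - 1) := by
    have : 2 * (2 * t) = 2 * (m * (2 * m - 1)) := by rw [← mul_assoc 2 m, ← hgauss]; ring
    omega
  have h6 : (m * (2 * m - 1)) % 2 = 1 := by
    rw [Nat.mul_mod, hodd, show (2 * m - 1) % 2 = 1 by omega]
  omega

/-- On a star of order `3 ^ r - 1`, let `z` be the element of `(ZMod 3) ^ r` that is not a weighted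
degree, and `w` the weighted degree of the centre. The weighted degrees add up to `-z` and to `2w`,
hence `z = w`. -/
theorem not_allGroupsIrregular_card_add_one {r : ℕ} {c : V}
    (hC : IsColorClass G {c}) (hV : Fintype.card V + 1 = 3 ^ r) :
    ¬ AllGroupsIrregular G (Fintype.card V + 1) := by
  intro h
  obtain ⟨f, hf⟩ := h (Fin r → ZMod 3) (by simp [hV])
  set w := weightedDegree G f
  have hcard : Fintype.card (Fin r → ZMod 3) = Fintype.card V + 1 := by simp [hV]
  have ho : Odd (Fintype.card (Fin r → ZMod 3)) := by
    rw [hcard, hV]; exact Odd.pow (by decide)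
  have himage : #(univ.image w)ᶜ = 1 := by
    rw [card_compl, card_image_of_injective _ hf, hcard, card_univ]; omega
  obtain ⟨z, hz⟩ := card_eq_one.1 himage
  have h1 := sum_add_sum_compl (univ.image w) (fun x => x)
  rw [hz, sum_singleton, eq_zero_of_add_self_eq_zero ho sum_add_sum_self,
    sum_image fun _ _ _ _ h => hf h, sum_weightedDegree, ← hC.sum_weightedDegree,
    sum_singleton] at h1
  have h3 : w c + w c + w c = 0 := by
    ext i
    have (x : ZMod 3) : x + x + x = 0 := by revert x; decide
    exact this _
  have hzc : z = w c := add_left_cancel (h1.trans h3.symm)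
  have : z ∈ (univ.image w)ᶜ := by rw [hz]; exact mem_singleton_self z
  rw [mem_compl, hzc] at this
  exact this (mem_image_of_mem w (mem_univ c))

theorem groupIrregularityStrength_eq {s : ℕ} (hs : 1 ≤ s) (h : AllGroupsIrregular G s)
    (hlt : ∀ t < s, 1 ≤ t → ¬ AllGroupsIrregular G t) : groupIrregularityStrength G = s := by
  refine le_antisymm (Nat.sInf_le ⟨hs, h⟩) (le_csInf ⟨s, hs, h⟩ ?_)
  rintro t ⟨ht, hall⟩
  by_contra! hts
  exact hlt t hts ht hall

end Obstruction

end GroupIrregularity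

theorem theorem1p1 {V : Type*} [Fintype V] [DecidableEq V] (G : SimpleGraph V)
    [DecidableRel G.Adj] (hG : G.Connected) (hn : 3 ≤ Fintype.card V) :
    (GroupIrregularity.IsExceptionalStar G →
      GroupIrregularity.groupIrregularityStrength G = Fintype.card V + 2) ∧
    (Fintype.card V ≡ 2 [MOD 4] ∧ ¬ GroupIrregularity.IsExceptionalStar G →
      GroupIrregularity.groupIrregularityStrength G = Fintype.card V + 1) ∧
    (¬ Fintype.card V ≡ 2 [MOD 4] ∧ ¬ GroupIrregularity.IsExceptionalStar G →
      GroupIrregularity.groupIrregularityStrength G = Fintype.card V) := by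
  open GroupIrregularity in
  refine ⟨?_, ?_, ?_⟩
  · rintro ⟨q, hq, ⟨e⟩⟩
    obtain ⟨c, hC, hV⟩ := exists_isColorClass_singleton_of_iso e
    have h8 : 3 ^ (2 * q + 1) % 8 = 3 := by
      rw [pow_succ, pow_mul, Nat.mul_mod, Nat.pow_mod]; simp
    have hV' : Fintype.card V + 1 = 3 ^ (2 * q + 1) := by omega
    refine groupIrregularityStrength_eq (by omega)
      (allGroupsIrregular_exceptionalStar hG hq hC hV') ?_
    intro t ht ht1 hall
    have hle := card_le_of_allGroupsIrregular ht1 hall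
    obtain rfl | rfl : t = Fintype.card V ∨ t = Fintype.card V + 1 := by omega
    · exact not_allGroupsIrregular_card (by unfold Nat.ModEq; omega) hall
    · exact not_allGroupsIrregular_card_add_one hC hV' hall
  · rintro ⟨h4, hstar⟩
    refine groupIrregularityStrength_eq (by omega)
      (allGroupsIrregular_card_add_one hG hn h4 hstar) ?_
    intro t ht ht1 hall
    have hle := card_le_of_allGroupsIrregular ht1 hall
    obtain rfl : t = Fintype.card V := by omega
    exact not_allGroupsIrregular_card h4 hall
  · rintro ⟨h4, -⟩
    refine groupIrregularityStrength_eq (by omega) (allGroupsIrregular_card hG hn h4) ?_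
    intro t ht ht1 hall
    have hle := card_le_of_allGroupsIrregular ht1 hall
    omega
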